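/- Identify $2^{\mathbb N}$ with the set of all subsets of $\mathbb N$, and let $K(2^{\mathbb N})$ be the Polish space of all closed subsets of $2^{\mathbb N}$ (with the Vietoris topology). For $K\in K(2^{\mathbb N})$ let $\downarrow K=\{x\in 2^{\mathbb N}:\exists y\in K\ (x\subseteq y)\}$, and call $K$ pseudo-tall if every infinite $x\in 2^{\mathbb N}$ has an infinite subset $y\subseteq x$ with $y\in\downarrow K$. A Borel pseudo-selector for a pseudo-tall $K$ is a Borel function $S:2^{\mathbb N}\to 2^{\mathbb N}$ such that for every $x\in 2^{\mathbb N}$: $S(x)\in\downarrow K$; $S(x)\subseteq x$; and $S(x)$ is infinite whenever $x$ is infinite. Theorem. The set of all $K\in K(2^{\mathbb N})$ that are pseudo-tall and have a Borel pseudo-selector is a $\mathbf\Sigma^1_2$ subset of $K(2^{\mathbb N})$, i.e. the projection of a $\mathbf\Pi^1_1$ (coanalytic) subset of $K(2^{\mathbb N})\times\mathbb N^{\mathbb N}$. -/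

import Mathlib

/-! ### Boldface projective classes -/

/-- `A` is `𝚷¹₁` (coanalytic): its complement is analytic. -/
def IsPi11 {X : Type*} [TopologicalSpace X] (A : Set X) : Prop :=
  MeasureTheory.AnalyticSet Aᶜ

/-- `A ⊆ X` is `𝚺¹₂`: it is the projection to `X` of a `𝚷¹₁` subset of `X × ℕ^ℕ`. -/
def IsSigma12 {X : Type*} [TopologicalSpace X] (A : Set X) : Prop :=
  ∃ C : Set (X × (ℕ → ℕ)), IsPi11 C ∧ A = Prod.fst '' C

/-! ### The Cantor space as the space of subsets of `ℕ` -/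

/-- The space `2^ℕ` with the product topology and its Borel σ-algebra; `x : Cantor` is identified
with the set `{n | x n = true}` of natural numbers. -/
abbrev Cantor : Type := ℕ → Bool

namespace Cantor

/-- The subset of `ℕ` with characteristic function `x`. -/
def toSet (x : Cantor) : Set ℕ := {n | x n = true}

end Cantor

/-- The hyperspace `K(2^ℕ)` of all closed (equivalently compact) subsets of `2^ℕ`, the empty set
included, with the Vietoris topology. -/
abbrev KCantor : Type := TopologicalSpace.Compacts Cantor

/-- The σ-algebra on `2^ℕ` used below is the Borel one. -/
theorem Cantor.borelSpace : BorelSpace Cantor := inferInstance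

/-- `K(2^ℕ)` is a Polish space. -/
theorem KCantor.polishSpace : PolishSpace KCantor := by
  let _ : MetricSpace KCantor := TopologicalSpace.metrizableSpaceMetric KCantor
  infer_instance

/-! ### Pseudo-tall sets and pseudo-selectors -/

/-- `↓K = {x : ∃ y ∈ K, x ⊆ y}`. -/
def downSet (K : KCantor) : Set Cantor :=
  {x | ∃ y ∈ K, x.toSet ⊆ y.toSet}

/-- `K` is pseudo-tall: every infinite `x` has an infinite subset that belongs to `↓K`. -/
def IsPseudoTall (K : KCantor) : Prop :=
  ∀ x : Cantor, x.toSet.Infinite → ∃ y ∈ downSet K, y.toSet.Infinite ∧ y.toSet ⊆ x.toSet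

/-- `S` is a Borel pseudo-selector for `K`. -/
structure IsBorelPseudoSelector (K : KCantor) (S : Cantor → Cantor) : Prop where
  measurable : Measurable S
  mem_downSet : ∀ x, S x ∈ downSet K
  infinite : ∀ x : Cantor, x.toSet.Infinite → (S x).toSet.Infinite
  subset : ∀ x, (S x).toSet ⊆ x.toSet

/-- `K` is pseudo-tall and has a Borel pseudo-selector. -/
def HasBorelPseudoSelector (K : KCantor) : Prop :=
  IsPseudoTall K ∧ ∃ S : Cantor → Cantor, IsBorelPseudoSelector K S

/-- Pseudo-tallness follows from the existence of a Borel pseudo-selector. -/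
theorem hasBorelPseudoSelector_iff (K : KCantor) :
    HasBorelPseudoSelector K ↔ ∃ S : Cantor → Cantor, IsBorelPseudoSelector K S :=
  ⟨fun h => h.2, fun ⟨S, hS⟩ =>
    ⟨fun x hx => ⟨S x, hS.mem_downSet x, hS.infinite x hx, hS.subset x⟩, S, hS⟩⟩

/-!
A Borel map `S : 2^ℕ → 2^ℕ` is coded by a labelled tree `T : List ℕ → ℕ`: a node labelled `m + 1`
stands for the clopen set `{x | x m = true}`, a node labelled `0` stands for the complement of the
union of the sets of its children, and the `n`-th child of the root stands for
`{x | S x n = true}`. For a well-founded tree, an *evaluation* at `x`, i.e. an assignment of truth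
values to the nodes that obeys these rules, exists, is unique, and is a Borel function of `x`
(`exists_measurable_isEval`); conversely every Borel set, hence every Borel map, has a code
(`exists_isCode`, `exists_tree_of_measurable`).

Consequently `K` has a Borel pseudo-selector if and only if there is a tree `T` which is
well-founded and such that for all `x` and all evaluations `e` of `T` at `x`, the set
`{n | e [n] = true}` is an admissible value for `K` at `x`. Because the evaluation is *universally*
quantified, and because the relation `y ∈ ↓K` is closed (`isClosed_setOf_mem_downSet`), the
condition on `(K, T)` is a universal quantifier over a Polish space in front of a Borel condition,
which is `𝚷¹₁`. The quantifier over `T` then gives `𝚺¹₂`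
(`isSigma12_setOf_exists_forall`).
-/

open MeasureTheory

/-! ### Projective classes -/

/-- A set defined by `∃ p, ∀ q` in front of a Borel relation, with `p` and `q` ranging over Polish
spaces, is `𝚺¹₂`. -/
theorem isSigma12_setOf_exists_forall {X P Q : Type*}
    [TopologicalSpace X] [PolishSpace X] [MeasurableSpace X] [BorelSpace X]
    [TopologicalSpace P] [PolishSpace P] [MeasurableSpace P] [BorelSpace P] [Nonempty P]
    [TopologicalSpace Q] [PolishSpace Q] [MeasurableSpace Q] [BorelSpace Q]
    {R : (X × P) × Q → Prop} (hR : Measurable R) :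
    IsSigma12 {x | ∃ p, ∀ q, R ((x, p), q)} := by
  obtain ⟨g, hg, hsurj⟩ := PolishSpace.exists_nat_nat_continuous_surjective P
  refine ⟨{y | ∀ q, R ((y.1, g y.2), q)}, ?_, ?_⟩
  · have hmeas : Measurable fun z : (X × (ℕ → ℕ)) × Q => ((z.1.1, g z.1.2), z.2) :=
      Continuous.measurable (by fun_prop)
    have hset : MeasurableSet {z : (X × (ℕ → ℕ)) × Q | ¬ R ((z.1.1, g z.1.2), z.2)} :=
      measurableSet_setOfPred.2 (hR.comp hmeas).not
    have := hset.analyticSet.image_of_continuous continuous_fst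
    unfold IsPi11
    convert! this using 1
    ext y
    simp
  · ext x
    simp only [Set.mem_ofPred_eq, Set.mem_image, Prod.exists, exists_and_right, exists_eq_right]
    exact hsurj.exists

/-! ### The relation `y ∈ ↓K` is closed -/

theorem isClosed_setOf_mem_compacts {X : Type*} [TopologicalSpace X] [T2Space X] :
    IsClosed {p : TopologicalSpace.Compacts X × X | p.2 ∈ p.1} := by
  have h := (TopologicalSpace.Compacts.isOpen_setOfPred_disjoint (α := X)).preimage
    (continuous_fst.prodMk
      (TopologicalSpace.Compacts.continuous_singleton.comp continuous_snd) :
      Continuous fun p : TopologicalSpace.Compacts X × X => (p.1, {p.2}))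
  convert! h.isClosed_compl using 1
  ext p
  simp [← TopologicalSpace.Compacts.disjoint_coe_iff]

/-- The witness `z ∈ K` with `y ⊆ z` ranges over a compact space, so the projection that eliminates
it preserves closedness. -/
theorem isClosed_setOf_mem_downSet :
    IsClosed {p : KCantor × Cantor | p.2 ∈ downSet p.1} := by
  have h : IsClosed {q : (KCantor × Cantor) × Cantor |
      q.2 ∈ q.1.1 ∧ ∀ n, q.1.2 n = true → q.2 n = true} := by
    have h₁ : IsClosed {q : (KCantor × Cantor) × Cantor | q.2 ∈ q.1.1} :=
      isClosed_setOf_mem_compacts.preimage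
        (by fun_prop : Continuous fun q : (KCantor × Cantor) × Cantor => (q.1.1, q.2))
    have h₂ : IsClosed {q : (KCantor × Cantor) × Cantor | ∀ n, q.1.2 n = true → q.2 n = true} := by
      simp only [Set.ofPred_forall]
      refine isClosed_iInter fun n => ?_
      exact (isClosed_discrete {b : Bool × Bool | b.1 = true → b.2 = true}).preimage
        (by fun_prop : Continuous fun q : (KCantor × Cantor) × Cantor => (q.1.2 n, q.2 n))
    exact h₁.inter h₂
  convert! isClosedMap_fst_of_compactSpace _ h using 1
  ext p
  simp [downSet, Cantor.toSet, Set.subset_def]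

/-! ### Trees coding Borel sets -/

/-- `IsChild T s' s`: the node `s` of the labelled tree `T` is not a leaf (its label is `0`), and
`s'` is one of its children `s ++ [k]`. -/
def IsChild (T : List ℕ → ℕ) (s' s : List ℕ) : Prop :=
  T s = 0 ∧ ∃ k, s' = s ++ [k]

/-- `e` assigns to each node of the labelled tree `T` the truth value of "`x` belongs to the set
coded at this node": a node labelled `m + 1` codes `{x | x m = true}`, a node labelled `0` codes the
complement of the union of the sets coded at its children. -/
def IsEval (T : List ℕ → ℕ) (x : Cantor) (e : List ℕ → Bool) : Prop :=
  ∀ s, (∀ m, T s = m + 1 → e s = x m) ∧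
    (T s = 0 → (e s = true ↔ ∀ k, e (s ++ [k]) = false))

/-- The labelled tree `T` is well-founded and codes the set `A` at its root. Since `T` is
well-founded, evaluations exist at each point, so that `T` codes only one set. -/
def IsCode (T : List ℕ → ℕ) (A : Set Cantor) : Prop :=
  WellFounded (IsChild T) ∧ ∀ x e, IsEval T x e → (e [] = true ↔ x ∈ A)

/-- The tree whose root is labelled `0` and whose `k`-th child is the root of a copy of `T k`. -/
def joinTree (T : ℕ → List ℕ → ℕ) : List ℕ → ℕ
  | [] => 0
  | k :: s => T k s

theorem wellFounded_isChild_joinTree {T : ℕ → List ℕ → ℕ}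
    (hT : ∀ k, WellFounded (IsChild (T k))) : WellFounded (IsChild (joinTree T)) := by
  have hcons : ∀ k s, Acc (IsChild (joinTree T)) (k :: s) := by
    intro k s
    induction s using (hT k).induction with
    | _ s ih =>
      refine Acc.intro _ ?_
      rintro _ ⟨h0, j, rfl⟩
      exact ih (s ++ [j]) ⟨h0, j, rfl⟩
  refine ⟨fun s => ?_⟩
  cases s with
  | nil =>
    refine Acc.intro _ ?_
    rintro _ ⟨-, j, rfl⟩
    exact hcons j []
  | cons k s => exact hcons k s

theorem IsEval.of_joinTree {T : ℕ → List ℕ → ℕ} {x : Cantor} {e : List ℕ → Bool}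
    (h : IsEval (joinTree T) x e) (k : ℕ) : IsEval (T k) x fun s => e (k :: s) :=
  fun s => h (k :: s)

theorem IsCode.joinTree {T : ℕ → List ℕ → ℕ} {A : ℕ → Set Cantor}
    (h : ∀ k, IsCode (T k) (A k)) : IsCode (joinTree T) (⋃ k, A k)ᶜ := by
  refine ⟨wellFounded_isChild_joinTree fun k => (h k).1, fun x e he => ?_⟩
  rw [(he []).2 rfl]
  simp only [Set.mem_compl_iff, Set.mem_iUnion, not_exists]
  refine forall_congr' fun k => ?_
  rw [← (h k).2 x _ (he.of_joinTree k)]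
  simp

theorem isCode_leaf (m : ℕ) : IsCode (fun _ => m + 1) {x | x m = true} := by
  refine ⟨⟨fun s => Acc.intro _ ?_⟩, fun x e he => ?_⟩
  · rintro _ ⟨h0, -⟩
    exact absurd h0 (Nat.succ_ne_zero m)
  · rw [(he []).1 m rfl]
    rfl

theorem exists_isCode_compl {A : Set Cantor} (h : ∃ T, IsCode T A) : ∃ T, IsCode T Aᶜ := by
  obtain ⟨T, hT⟩ := h
  have := IsCode.joinTree fun _ : ℕ => hT
  rw [Set.iUnion_const] at this
  exact ⟨_, this⟩

theorem exists_isCode_iUnion {A : ℕ → Set Cantor} (h : ∀ k, ∃ T, IsCode T (A k)) :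
    ∃ T, IsCode T (⋃ k, A k) := by
  choose T hT using h
  have := exists_isCode_compl ⟨_, IsCode.joinTree hT⟩
  rwa [compl_compl] at this

theorem exists_isCode_empty : ∃ T, IsCode T ∅ := by
  -- `∅` is the complement of the union of a set and its complement.
  obtain ⟨T, hT⟩ := exists_isCode_compl ⟨_, isCode_leaf 0⟩
  have h : ∀ k : ℕ, ∃ T', IsCode T' (if k = 0 then {x | x 0 = true} else {x | x 0 = true}ᶜ) := by
    intro k
    split_ifs
    exacts [⟨_, isCode_leaf 0⟩, ⟨T, hT⟩]
  obtain ⟨T', hT'⟩ := exists_isCode_compl (exists_isCode_iUnion h)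
  refine ⟨T', ?_⟩
  convert! hT'
  symm
  rw [Set.compl_empty_iff, Set.eq_univ_iff_forall]
  intro x
  by_cases hx : x 0 = true
  · exact Set.mem_iUnion.2 ⟨0, by simpa using hx⟩
  · exact Set.mem_iUnion.2 ⟨1, by simpa using hx⟩

/-- The coded sets form a σ-algebra that contains the subbasic clopen sets of `2^ℕ`. -/
theorem exists_isCode {A : Set Cantor} (hA : MeasurableSet A) : ∃ T, IsCode T A := by
  let m : MeasurableSpace Cantor :=
    { MeasurableSet' := fun A => ∃ T, IsCode T A
      measurableSet_empty := exists_isCode_empty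
      measurableSet_compl := fun _ => exists_isCode_compl
      measurableSet_iUnion := fun _ => exists_isCode_iUnion }
  have hle : MeasurableSpace.pi ≤ m := by
    refine iSup_le fun n => Measurable.comap_le ?_
    exact @measurable_to_bool _ m _ ⟨_, isCode_leaf n⟩
  exact hle _ hA

theorem exists_tree_of_measurable {S : Cantor → Cantor} (hS : Measurable S) :
    ∃ T, WellFounded (IsChild T) ∧ ∀ x e, IsEval T x e → (fun n => e [n]) = S x := by
  have h : ∀ n, ∃ T, IsCode T {x | S x n = true} := fun n =>
    exists_isCode (((measurable_pi_apply n).comp hS) (measurableSet_singleton true))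
  choose T hT using h
  refine ⟨joinTree T, wellFounded_isChild_joinTree fun n => (hT n).1, fun x e he => ?_⟩
  ext n
  exact Bool.eq_iff_iff.2 ((hT n).2 x _ (he.of_joinTree n))

/-- Evaluation by recursion along a well-founded tree; each node involves only countably many
other nodes, so each value is Borel in `x`. -/
theorem exists_measurable_isEval {T : List ℕ → ℕ} (hT : WellFounded (IsChild T)) :
    ∃ E : Cantor → List ℕ → Bool, Measurable E ∧ ∀ x, IsEval T x (E x) := by
  classical
  let F : Cantor → ∀ s : List ℕ, (∀ s', IsChild T s' s → Bool) → Bool := fun x s rec =>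
    if h0 : T s = 0 then decide (∀ k, rec (s ++ [k]) ⟨h0, k, rfl⟩ = false) else x (T s - 1)
  let E : Cantor → List ℕ → Bool := fun x s => hT.fix (F x) s
  have hE : ∀ x s, E x s =
      if T s = 0 then decide (∀ k, E x (s ++ [k]) = false) else x (T s - 1) := by
    intro x s
    change hT.fix (F x) s = _
    rw [hT.fix_eq]
    by_cases h0 : T s = 0 <;> simp only [F, E, h0, dite_true, dite_false, if_true, if_false]
  refine ⟨E, measurable_pi_iff.2 fun s => ?_, fun x s => ⟨fun m hm => ?_, fun h0 => ?_⟩⟩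
  · induction s using hT.induction with
    | _ s ih =>
      by_cases h0 : T s = 0
      · simp only [hE _ s, h0, if_true]
        refine measurable_to_bool ?_
        have : MeasurableSet {x | ∀ k, E x (s ++ [k]) = false} := by
          simp only [Set.ofPred_forall]
          exact MeasurableSet.iInter fun k =>
            ih (s ++ [k]) ⟨h0, k, rfl⟩ (measurableSet_singleton false)
        convert! this using 1
        ext x
        simp
      · simp only [hE _ s, h0, if_false]
        exact measurable_pi_apply _
  · rw [hE, hm]
    simp
  · rw [hE, if_pos h0]
    simp

/-! ### Complexity of the coding relations -/

theorem measurable_apply_eq {α ι β : Type*} [MeasurableSpace α] [MeasurableSpace β]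
    [MeasurableSingletonClass β] {f : α → ι → β} (hf : Measurable f) (i : ι) (b : β) :
    Measurable fun a => f a i = b :=
  measurableSet_setOfPred.1 (((measurable_pi_apply i).comp hf) (measurableSet_singleton b))

/-- Well-foundedness of trees as a universal statement about points of `ℕ^ℕ`, which encode
sequences of nodes. -/
theorem wellFounded_isChild_iff {T : List ℕ → ℕ} :
    WellFounded (IsChild T) ↔ ∀ z : ℕ → ℕ, ∃ n, ∀ s s' : List ℕ,
      z n = Encodable.encode s → z (n + 1) = Encodable.encode s' → ¬ IsChild T s' s := by
  rw [wellFounded_iff_isEmpty_descending_chain]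
  constructor
  · intro h z
    by_contra! hz
    choose s s' hs hs' hc using hz
    have hss : ∀ n, s' n = s (n + 1) := fun n =>
      Encodable.encode_injective ((hs' n).symm.trans (hs (n + 1)))
    exact h.elim ⟨s, fun n => hss n ▸ hc n⟩
  · intro h
    refine ⟨fun ⟨f, hf⟩ => ?_⟩
    obtain ⟨n, hn⟩ := h fun n => Encodable.encode (f n)
    exact hn _ _ rfl rfl (hf n)

theorem measurable_isChild {α : Type*} [MeasurableSpace α] {T : α → List ℕ → ℕ}
    (hT : Measurable T) (s' s : List ℕ) : Measurable fun a => IsChild (T a) s' s :=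
  (measurable_apply_eq hT s 0).and measurable_const

theorem measurable_isEval {α : Type*} [MeasurableSpace α] {T : α → List ℕ → ℕ}
    {x : α → Cantor} {e : α → List ℕ → Bool} (hT : Measurable T) (hx : Measurable x)
    (he : Measurable e) : Measurable fun a => IsEval (T a) (x a) (e a) := by
  refine Measurable.forall fun s => Measurable.and (Measurable.forall fun m => ?_) ?_
  · refine (measurable_apply_eq hT s (m + 1)).imp (measurableSet_setOfPred.1 ?_)
    exact measurableSet_eq_fun ((measurable_pi_apply s).comp he) ((measurable_pi_apply m).comp hx)
  · exact (measurable_apply_eq hT s 0).imp ((measurable_apply_eq he s true).iff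
      (Measurable.forall fun k => measurable_apply_eq he _ false))

theorem measurable_infinite_toSet {α : Type*} [MeasurableSpace α] {x : α → Cantor}
    (hx : Measurable x) : Measurable fun a => (x a).toSet.Infinite := by
  have : ∀ a, (x a).toSet.Infinite ↔ ∀ n, ∃ m, x a m = true ∧ n < m := fun a =>
    ⟨fun h n => h.exists_gt n, Set.infinite_of_forall_exists_gt⟩
  simp only [this]
  exact Measurable.forall fun n => Measurable.exists fun m =>
    (measurable_apply_eq hx m true).and measurable_const

/-! ### Pseudo-selectors -/

/-- `y` is an admissible value at `x` of a pseudo-selector for `K`. -/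
def IsAdmissible (K : KCantor) (x y : Cantor) : Prop :=
  y ∈ downSet K ∧ (x.toSet.Infinite → y.toSet.Infinite) ∧ ∀ n, y n = true → x n = true

theorem measurable_isAdmissible {α : Type*} [MeasurableSpace α] [MeasurableSpace KCantor]
    [BorelSpace KCantor] {K : α → KCantor} {x y : α → Cantor} (hK : Measurable K)
    (hx : Measurable x) (hy : Measurable y) :
    Measurable fun a => IsAdmissible (K a) (x a) (y a) := by
  refine Measurable.and ?_ (Measurable.and ?_ (Measurable.forall fun n => ?_))
  · exact measurableSet_setOfPred.1 ((hK.prodMk hy) isClosed_setOf_mem_downSet.measurableSet)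
  · exact (measurable_infinite_toSet hx).imp (measurable_infinite_toSet hy)
  · exact (measurable_apply_eq hy n true).imp (measurable_apply_eq hx n true)

theorem hasBorelPseudoSelector_iff_exists_tree (K : KCantor) :
    HasBorelPseudoSelector K ↔ ∃ T : List ℕ → ℕ, WellFounded (IsChild T) ∧
      ∀ x e, IsEval T x e → IsAdmissible K x fun n => e [n] := by
  rw [hasBorelPseudoSelector_iff]
  constructor
  · rintro ⟨S, hS⟩
    obtain ⟨T, hT, hTS⟩ := exists_tree_of_measurable hS.measurable
    refine ⟨T, hT, fun x e he => ?_⟩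
    rw [hTS x e he]
    exact ⟨hS.mem_downSet x, hS.infinite x, fun n hn => hS.subset x hn⟩
  · rintro ⟨T, hT, h⟩
    obtain ⟨E, hEm, hE⟩ := exists_measurable_isEval hT
    exact ⟨fun x n => E x [n],
      { measurable := measurable_pi_iff.2 fun n => (measurable_pi_apply [n]).comp hEm
        mem_downSet := fun x => (h x _ (hE x)).1
        infinite := fun x => (h x _ (hE x)).2.1
        subset := fun x n hn => (h x _ (hE x)).2.2 n hn }⟩

theorem mainTheorem6 : IsSigma12 {K : KCantor | HasBorelPseudoSelector K} := by
  let _ : MeasurableSpace KCantor := borel KCantor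
  have _ : BorelSpace KCantor := ⟨rfl⟩
  have _ : PolishSpace KCantor := KCantor.polishSpace
  -- One universal quantifier over `(z, x, e)` serves for well-foundedness (`z`) and for
  -- admissibility of the coded values (`x` and `e`).
  let R : (KCantor × (List ℕ → ℕ)) × ((ℕ → ℕ) × Cantor × (List ℕ → Bool)) → Prop := fun p =>
    (∃ n, ∀ s s' : List ℕ, p.2.1 n = Encodable.encode s →
      p.2.1 (n + 1) = Encodable.encode s' → ¬ IsChild p.1.2 s' s) ∧
    (IsEval p.1.2 p.2.2.1 p.2.2.2 → IsAdmissible p.1.1 p.2.2.1 fun n => p.2.2.2 [n])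
  have hR : Measurable R := by
    refine Measurable.and ?_ ?_
    · refine Measurable.exists fun n => Measurable.forall fun s => Measurable.forall fun s' => ?_
      have hz : Measurable fun p : (KCantor × (List ℕ → ℕ)) ×
          ((ℕ → ℕ) × Cantor × (List ℕ → Bool)) => p.2.1 := by fun_prop
      exact (measurable_apply_eq hz _ _).imp ((measurable_apply_eq hz _ _).imp
        (measurable_isChild (by fun_prop) s' s).not)
    · exact (measurable_isEval (by fun_prop) (by fun_prop) (by fun_prop)).imp
        (measurable_isAdmissible (by fun_prop) (by fun_prop) (by fun_prop))
  have _ : PolishSpace (Cantor × (List ℕ → Bool)) := { }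
  have hsigma : IsSigma12 {K | ∃ T, ∀ q, R ((K, T), q)} := isSigma12_setOf_exists_forall hR
  convert! hsigma using 1
  ext K
  simp only [Set.mem_ofPred_eq, hasBorelPseudoSelector_iff_exists_tree, wellFounded_isChild_iff]
  refine exists_congr fun T => ⟨fun h q => ⟨h.1 q.1, h.2 q.2.1 q.2.2⟩, fun h => ⟨fun z => ?_, ?_⟩⟩
  · exact (h (z, fun _ => false, fun _ => false)).1
  · exact fun x e => (h (fun _ => 0, x, e)).2
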